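/- Let $b,s,m,z$ be non-negative integers with $1\le s<b$, $m\ge 4b$, $(2b-s)\nmid m$, $z\equiv m \pmod{2b-s}$ and $z\le b$. Put $t=2b-s$, $r=2^b$ and $$\ell=\frac{2^m-2^{t}(2^z-1)-1}{2^{t}-1}.$$ Then $\ell$ is a non-negative integer and $\mathbb F_2^m$ has a partial $t$-spread of size $\ell$, that is, $t$-dimensional subspaces $W_1,\dots,W_\ell$ with $W_i\cap W_j=\{0\}$ for $i\ne j$. Let $W_1,\dots,W_\ell$ be any such partial $t$-spread, let $G_{W_i}\in\mathbb F_2^{m\times t}$ be a matrix whose columns form a basis of $W_i$, let $G_U\in\mathbb F_2^{s\times s}$ be invertible, and let $A=\binom{A_1}{A_2}$ with $A_1\in\mathbb F_2^{s\times r}$, $A_2\in\mathbb F_2^{t\times r}$ be a desired matrix, i.e. $A$ has rank $s+t=2b$, any two columns of $A_2$ are linearly independent, and any four columns of $A$ are linearly independent. Set $$H_G^i=\left(\mathbf 0_{(s+m)\times 1},\ \begin{pmatrix}G_U&0\\0&G_{W_i}\end{pmatrix}A\right)\in\mathbb F_2^{(s+m)\times(r+1)},\qquad H=\begin{pmatrix}H_1&\cdots&H_\ell\\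 H_G^1&\cdots&H_G^\ell\end{pmatrix},$$ where $H_i\in\mathbb F_2^{\ell\times(r+1)}$ has all-one $i$-th row and zeros elsewhere. Then the binary linear code $\mathcal C$ with parity check matrix $H$ has length $n=(r+1)\ell$, dimension $k=n-\ell-s-m$ and minimum distance $d\ge 6$. It is locally repairable with locality $r=2^b$ (for every coordinate $i$ there is a set $R_i\not\ni i$ of at most $r$ coordinates with $c_i=\sum_{j\in R_i}c_j$ for all $c\in\mathcal C$), with disjoint local repair groups (the dual code contains $n/(r+1)$ words of weight $r+1$ with pairwise disjoint supports). Moreover $\mathcal C$ is $k$-optimal: $2\le r\le \frac n2-2$, and $k$ attains the bound $k\le\frac{rn}{r+1}-\min\{\log_2(1+\frac{rn}{2}),\frac{rn}{(r+1)(r+2)}\}$ for binary linear locally repairable codes with $d\ge5$, in the sense that $$k=\left\lfloor \frac{rn}{r+1}-\min\left\{\log_2\Bigl(1+\frac{rn}{2}\Bigr),\ \frac{rn}{(r+1)(r+2)}\right\}\right\rfloor .$$ -/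

import Mathlib

namespace BinLRC

/-- The binary linear code with parity check matrix `H`. -/
def parityCheckCode {ρ ι : Type*} [Fintype ι] (H : Matrix ρ ι (ZMod 2)) :
    Submodule (ZMod 2) (ι → ZMod 2) :=
  LinearMap.ker H.mulVecLin

/-- The minimum Hamming distance between distinct codewords (`0` if there are no two distinct
codewords, so that a positive lower bound also asserts that the code is not trivial). -/
noncomputable def minDist {ι : Type*} [Fintype ι] (C : Submodule (ZMod 2) (ι → ZMod 2)) : ℕ :=
  sInf {d : ℕ | ∃ x ∈ C, ∃ y ∈ C, x ≠ y ∧ hammingDist x y = d}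

/-- Locality `r`: every symbol is the sum of at most `r` other symbols, at fixed positions. -/
def HasLocality {ι : Type*} (C : Submodule (ZMod 2) (ι → ZMod 2)) (r : ℕ) : Prop :=
  ∀ i : ι, ∃ R : Finset ι, i ∉ R ∧ R.card ≤ r ∧ ∀ c ∈ C, c i = ∑ j ∈ R, c j

/-- `n / (r + 1)` words of the dual code, of weight `r + 1` and with pairwise disjoint supports. -/
def HasDisjointRepairGroups {ι : Type*} [Fintype ι] (C : Submodule (ZMod 2) (ι → ZMod 2))
    (r : ℕ) : Prop :=
  ∃ l : ℕ, Fintype.card ι = (r + 1) * l ∧ ∃ h : Fin l → ι → ZMod 2,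
    (∀ i, ∀ c ∈ C, h i ⬝ᵥ c = 0) ∧
    (∀ i, hammingNorm (h i) = r + 1) ∧
    Pairwise fun i j => Disjoint (Function.support (h i)) (Function.support (h j))

/-- The right-hand side of the explicit upper bound on the dimension of a binary linear LRC of
length `n` and locality `r` with minimum distance at least `5`, where `2 ≤ r ≤ n / 2 - 2`. -/
noncomputable def dimBound (n r : ℕ) : ℝ :=
  (r * n : ℝ) / (r + 1) -
    min (Real.logb 2 (1 + (r * n : ℝ) / 2)) ((r * n : ℝ) / ((r + 1) * (r + 2)))

/-- A binary linear LRC in the range of the bound whose dimension is the largest integer that the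
bound allows. -/
def IsKOptimal {ι : Type*} [Fintype ι] (C : Submodule (ZMod 2) (ι → ZMod 2)) (r : ℕ) : Prop :=
  HasLocality C r ∧ 5 ≤ minDist C ∧ 2 ≤ r ∧ (r : ℝ) ≤ (Fintype.card ι : ℝ) / 2 - 2 ∧
    (Module.finrank (ZMod 2) C : ℤ) = ⌊dimBound (Fintype.card ι) r⌋

/-- A partial `t`-spread of `F_2^m` of size `l`. -/
def IsPartialSpread {m l : ℕ} (t : ℕ) (W : Fin l → Submodule (ZMod 2) (Fin m → ZMod 2)) : Prop :=
  (∀ i, Module.finrank (ZMod 2) (W i) = t) ∧ Pairwise fun i j => W i ⊓ W j = ⊥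

/-- The matrix with upper part `A₁` and lower part `A₂` is a desired matrix. -/
structure IsDesired {s t r : ℕ} (A₁ : Matrix (Fin s) (Fin r) (ZMod 2))
    (A₂ : Matrix (Fin t) (Fin r) (ZMod 2)) : Prop where
  lt_two_pow : r < 2 ^ t
  lt_rows : s < t
  /-- any two columns of `A₂` (at different positions) are linearly independent -/
  two_cols : ∀ j : Fin 2 ↪ Fin r, LinearIndependent (ZMod 2) fun a => A₂.col (j a)
  /-- the rows of the whole matrix are linearly independent -/
  full_rank : (Matrix.fromRows A₁ A₂).rank = s + t
  /-- for `t ≥ 3`, any four columns of the whole matrix are linearly independent -/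
  four_cols : 3 ≤ t → ∀ j : Fin 4 ↪ Fin r,
    LinearIndependent (ZMod 2) fun a => (Matrix.fromRows A₁ A₂).col (j a)

/-- The matrix whose columns are the vectors of a given basis of the subspace `W`. -/
noncomputable def basisMatrix {m t : ℕ} {W : Submodule (ZMod 2) (Fin m → ZMod 2)}
    (e : Module.Basis (Fin t) (ZMod 2) W) : Matrix (Fin m) (Fin t) (ZMod 2) :=
  Matrix.of fun x j => (e j : Fin m → ZMod 2) x

/-- The block `(0, G_M * A)`, where `G_M` is block diagonal with blocks `GU` and `GW`. -/
def blockHG {s t m r : ℕ} (GU : Matrix (Fin s) (Fin s) (ZMod 2))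
    (GW : Matrix (Fin m) (Fin t) (ZMod 2)) (A : Matrix (Fin s ⊕ Fin t) (Fin r) (ZMod 2)) :
    Matrix (Fin s ⊕ Fin m) (Fin (r + 1)) (ZMod 2) :=
  Matrix.of fun x => Fin.cons 0 ((Matrix.fromBlocks GU 0 0 GW * A) x)

/-- The parity check matrix with `l` blocks of `r + 1` columns: column `(i, j)` has the `i`-th unit
vector above and column `j` of `HG i` below. -/
def parityCheckMatrix {l r : ℕ} {ρ : Type*} (HG : Fin l → Matrix ρ (Fin (r + 1)) (ZMod 2)) :
    Matrix (Fin l ⊕ ρ) (Fin l × Fin (r + 1)) (ZMod 2) :=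
  Matrix.fromRows (Matrix.of fun i p => if p.1 = i then 1 else 0)
    (Matrix.of fun x p => HG p.1 x p.2)

/-- The code of the construction, from an `s × s` matrix `GU`, subspaces `W i` with bases `e i`,
and the matrix with upper part `A₁` and lower part `A₂`. -/
noncomputable def spreadCode {s t m r l : ℕ} (GU : Matrix (Fin s) (Fin s) (ZMod 2))
    {W : Fin l → Submodule (ZMod 2) (Fin m → ZMod 2)}
    (e : ∀ i, Module.Basis (Fin t) (ZMod 2) (W i))
    (A₁ : Matrix (Fin s) (Fin r) (ZMod 2)) (A₂ : Matrix (Fin t) (Fin r) (ZMod 2)) :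
    Submodule (ZMod 2) (Fin l × Fin (r + 1) → ZMod 2) :=
  parityCheckCode
    (parityCheckMatrix fun i => blockHG GU (basisMatrix (e i)) (Matrix.fromRows A₁ A₂))

end BinLRC

/-! ### Partial spreads: existence and spanning -/

namespace BinLRC
open Module

/-! A spread grows from dimension `m` to `t + m` by adding the `2 ^ m` graphs of `x ↦ a * φ x`,
where `a` runs over the field of order `2 ^ m`; from one subspace in dimension `t + z` this reaches
the size `l`.

The dimension says that the rows of `H` are independent. For an arbitrary spread this needs the `W
i` to span, and they do because their union fills more than half of the space.

For the distance, every block of a codeword has even weight, so a nonzero word of weight below 6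
meets one block in weight at most 4, excluded by `four_cols`, or two blocks in weight 2 each,
excluded by `W i ⊓ W k = ⊥` and `two_cols`.

For optimality, both terms of the minimum exceed `s + m - 1` and the logarithm is at most `s + m`;
hence the floor is `r * l - (s + m)`, the dimension. -/

theorem exists_isPartialSpread_of_finrank_eq {t l m : ℕ} {ι V : Type*} [Finite ι]
    [AddCommGroup V] [Module (ZMod 2) V] [FiniteDimensional (ZMod 2) V]
    (hV : finrank (ZMod 2) V = m) (hι : Nat.card ι = l) (W : ι → Submodule (ZMod 2) V)
    (hW : ∀ i, finrank (ZMod 2) (W i) = t) (hd : Pairwise fun i j => W i ⊓ W j = ⊥) :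
    ∃ W' : Fin l → Submodule (ZMod 2) (Fin m → ZMod 2), IsPartialSpread t W' := by
  let f : V ≃ₗ[ZMod 2] (Fin m → ZMod 2) := LinearEquiv.ofFinrankEq _ _ (by simp [hV])
  let g : Fin l ≃ ι := (Finite.equivFinOfCardEq hι).symm
  refine ⟨fun i => (W (g i)).map (f : V →ₗ[ZMod 2] (Fin m → ZMod 2)),
    fun i => ?_, fun i j hij => ?_⟩
  · rw [LinearEquiv.finrank_map_eq, hW]
  · change Submodule.map _ _ ⊓ Submodule.map _ _ = ⊥
    rw [← Submodule.map_inf _ f.injective, hd (g.injective.ne hij), Submodule.map_bot]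

/-- Two graphs meet where `(a - c) * φ x = 0`, hence only at 0, as `φ` is injective into a field.
The old spread is placed in `0 × K`, which meets each graph trivially. -/
theorem exists_isPartialSpread_add {t m l : ℕ} (hm : m ≠ 0) (htm : t ≤ m)
    (W : Fin l → Submodule (ZMod 2) (Fin m → ZMod 2)) (hW : IsPartialSpread t W) :
    ∃ W' : Fin (2 ^ m + l) → Submodule (ZMod 2) (Fin (t + m) → ZMod 2), IsPartialSpread t W' := by
  let K := GaloisField 2 m
  let ψ : (Fin m → ZMod 2) ≃ₗ[ZMod 2] K :=
    LinearEquiv.ofFinrankEq _ _ (by simp [K, GaloisField.finrank 2 hm])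
  obtain ⟨φ, hφ⟩ : ∃ φ : (Fin t → ZMod 2) →ₗ[ZMod 2] K, Function.Injective φ :=
    finrank_le_iff_exists_linearMap.1 (by simpa [K, GaloisField.finrank 2 hm] using htm)
  let ρ : (Fin m → ZMod 2) →ₗ[ZMod 2] (Fin t → ZMod 2) × K :=
    LinearMap.inr _ _ _ ∘ₗ ψ.toLinearMap
  have hρ : Function.Injective ρ := LinearMap.inr_injective.comp ψ.injective
  let U : K ⊕ Fin l → Submodule (ZMod 2) ((Fin t → ZMod 2) × K) :=
    Sum.elim (fun a => (LinearMap.mulLeft (ZMod 2) a ∘ₗ φ).graph) (fun i => (W i).map ρ)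
  have hgi : ∀ a i, U (.inl a) ⊓ U (.inr i) = ⊥ := by
    intro a i
    rw [eq_bot_iff]
    rintro ⟨x, y⟩ ⟨h₁, h₂⟩
    obtain ⟨w, -, hw⟩ := Submodule.mem_map.1 h₂
    have hx : x = 0 := (congrArg Prod.fst hw).symm
    have hy : y = a * φ x := (LinearMap.mem_graph_iff _ _).1 h₁
    simp [hx, hy]
  refine exists_isPartialSpread_of_finrank_eq (ι := K ⊕ Fin l) ?_ ?_ U ?_ ?_
  · rw [finrank_prod, GaloisField.finrank 2 hm]; simp
  · rw [Nat.card_sum, GaloisField.card 2 m hm]; simp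
  · rintro (a | i)
    · have hU : U (.inl a) =
          LinearMap.range (LinearMap.id.prod (LinearMap.mulLeft (ZMod 2) a ∘ₗ φ)) :=
        LinearMap.graph_eq_range_prod _
      rw [hU]
      refine (LinearMap.finrank_range_of_inj fun x y h => congrArg Prod.fst h).trans ?_
      simp
    · exact (Submodule.equivMapOfInjective ρ hρ (W i)).finrank_eq.symm.trans (hW.1 i)
  · rintro (a | i) (c | j) hij
    · change U (.inl a) ⊓ U (.inl c) = ⊥
      rw [eq_bot_iff]
      rintro ⟨x, y⟩ ⟨h₁, h₂⟩
      have h₁ : y = a * φ x := (LinearMap.mem_graph_iff _ _).1 h₁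
      have h₂ : y = c * φ x := (LinearMap.mem_graph_iff _ _).1 h₂
      have hac : a - c ≠ 0 := sub_ne_zero.2 fun h => hij (congrArg _ h)
      have h0 : (a - c) * φ x = 0 := by rw [sub_mul, ← h₁, ← h₂, sub_self]
      have hφx : φ x = 0 := (mul_eq_zero.1 h0).resolve_left hac
      have hx : x = 0 := hφ (by rw [hφx, map_zero])
      simp [hx, h₁]
    · exact hgi a j
    · exact (inf_comm _ _).trans (hgi c i)
    · change (W i).map ρ ⊓ (W j).map ρ = ⊥
      rw [← Submodule.map_inf _ hρ, hW.2 (fun h => hij (congrArg _ h)), Submodule.map_bot]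

/-- The equation is the formula for `l` with the denominator cleared and without subtraction. -/
theorem exists_isPartialSpread (t z : ℕ) (ht : t ≠ 0) (q : ℕ) :
    ∃ l : ℕ, l * 2 ^ t + 2 ^ (t + z) + 1 = 2 ^ (t * (q + 1) + z) + 2 ^ t + l ∧
      ∃ W : Fin l → Submodule (ZMod 2) (Fin (t * (q + 1) + z) → ZMod 2), IsPartialSpread t W := by
  induction q with
  | zero =>
    obtain ⟨φ, hφ⟩ : ∃ φ : (Fin t → ZMod 2) →ₗ[ZMod 2] (Fin (t * (0 + 1) + z) → ZMod 2),
        Function.Injective φ := finrank_le_iff_exists_linearMap.1 (by simp)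
    have hU : finrank (ZMod 2) (LinearMap.range φ) = t :=
      (LinearMap.finrank_range_of_inj hφ).trans (by simp)
    exact ⟨1, by ring, fun _ => LinearMap.range φ, fun _ => hU,
      fun i j h => (h (Subsingleton.elim i j)).elim⟩
  | succ q ih =>
    obtain ⟨l, hl, W, hW⟩ := ih
    have h := exists_isPartialSpread_add (by positivity) (by nlinarith) W hW
    rw [show t + (t * (q + 1) + z) = t * (q + 1 + 1) + z by ring] at h
    refine ⟨_, ?_, h⟩
    rw [show t * (q + 1 + 1) + z = t + (t * (q + 1) + z) by ring, pow_add 2 t (t * (q + 1) + z)]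
    linarith

theorem iSup_eq_top_of_isPartialSpread {m l t : ℕ}
    {W : Fin l → Submodule (ZMod 2) (Fin m → ZMod 2)} (hW : IsPartialSpread t W)
    (hcard : 2 ^ m < 2 * (l * (2 ^ t - 1) + 1)) : ⨆ i, W i = ⊤ := by
  by_contra hne
  set S := ⨆ i, W i with hS
  have hSm : finrank (ZMod 2) S + 1 ≤ m := by
    simpa using Submodule.finrank_lt hne
  have hcS : Nat.card S = 2 ^ finrank (ZMod 2) S := by
    simpa using Module.natCard_eq_pow_finrank (K := ZMod 2) (V := S)
  have hcW : ∀ i, Nat.card {x : W i // x ≠ 0} = 2 ^ t - 1 := by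
    intro i
    have h : Nat.card (W i) = 2 ^ t := by
      simpa [hW.1 i] using Module.natCard_eq_pow_finrank (K := ZMod 2) (V := W i)
    classical
    rw [Nat.card_eq_fintype_card] at h ⊢
    rw [Fintype.card_subtype_compl, Fintype.card_subtype_eq, h]
  -- Zero and the pairwise disjoint sets of nonzero vectors inject into the span, which has at most
  -- `2 ^ (m - 1)` elements if proper.
  let f : Option (Σ i, {x : W i // x ≠ 0}) → S := fun o =>
    o.elim 0 fun p => ⟨p.2.1, le_iSup W p.1 p.2.1.2⟩
  have hf : Function.Injective f := by
    have h0 : ∀ p : Σ i, {x : W i // x ≠ 0}, f (some p) ≠ 0 := fun p h =>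
      p.2.2 (Subtype.ext (congrArg (fun y : S => (y : Fin m → ZMod 2)) h))
    rintro (_ | ⟨i, x, hx⟩) (_ | ⟨j, y, hy⟩) h
    · rfl
    · exact (h0 _ h.symm).elim
    · exact (h0 _ h).elim
    · have hxy : (x : Fin m → ZMod 2) = y := congrArg Subtype.val h
      obtain rfl | hij := eq_or_ne i j
      · obtain rfl : x = y := Subtype.ext hxy
        rfl
      · have hmem : (x : Fin m → ZMod 2) ∈ W i ⊓ W j := ⟨x.2, hxy ▸ y.2⟩
        rw [hW.2 hij, Submodule.mem_bot] at hmem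
        exact (hx (Subtype.ext hmem)).elim
  have hle := Nat.card_le_card_of_injective f hf
  rw [Finite.card_option, Nat.card_sigma, hcS] at hle
  simp only [hcW, Finset.sum_const, Finset.card_univ, Fintype.card_fin, smul_eq_mul] at hle
  have hpow : 2 ^ (finrank (ZMod 2) S + 1) ≤ 2 ^ m := Nat.pow_le_pow_right two_pos hSm
  rw [pow_succ] at hpow
  omega
end BinLRC

/-! ### The code: dimension, distance and locality -/

namespace BinLRC
open Module Matrix

/-- The support is padded to exactly `k` positions, which is why `k ≤ Fintype.card ι` is required.
-/
theorem eq_zero_of_sum_smul_eq_zero_of_card_le {K V ι : Type*} [Field K] [DecidableEq K]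
    [AddCommGroup V] [Module K V] [Fintype ι] {k : ℕ} (hk : k ≤ Fintype.card ι) {v : ι → V}
    (hv : ∀ j : Fin k ↪ ι, LinearIndependent K fun a => v (j a)) {f : ι → K}
    (hf : hammingNorm f ≤ k) (h0 : ∑ i, f i • v i = 0) : f = 0 := by
  classical
  obtain ⟨T, hT, hTk⟩ := Finset.exists_superset_card_eq (s := {i | f i ≠ 0}) hf hk
  let j : Fin k ↪ ι := (T.equivFinOfCardEq hTk).symm.toEmbedding.trans (.subtype _)
  have hjT : ∀ i, i ∈ T → ∃ a, j a = i := fun i hi => ⟨T.equivFinOfCardEq hTk ⟨i, hi⟩, by simp [j]⟩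
  have hz : ∀ i, i ∉ T → f i = 0 := fun i hi => by
    by_contra h
    exact hi (hT (by simpa using h))
  have hsum : ∑ a, f (j a) • v (j a) = 0 := by
    rw [← h0, ← Finset.sum_map Finset.univ j fun i => f i • v i]
    refine Finset.sum_subset (Finset.subset_univ _) fun i _ hi => ?_
    rw [hz i, zero_smul]
    intro hiT
    obtain ⟨a, rfl⟩ := hjT i hiT
    exact hi (by simp)
  have hj := Fintype.linearIndependent_iff.1 (hv j) (fun a => f (j a)) hsum
  funext i
  by_cases hi : i ∈ T
  · obtain ⟨a, rfl⟩ := hjT i hi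
    exact hj a
  · exact hz i hi

theorem vecMul_injective_of_rank_eq_card {K m n : Type*} [Field K] [Fintype m] [Fintype n]
    {M : Matrix m n K} (h : M.rank = Fintype.card m) : Function.Injective M.vecMul := by
  rw [Matrix.vecMul_injective_iff, linearIndependent_iff_card_eq_finrank_span, ← h,
    Matrix.rank_eq_finrank_span_row]
  rfl

theorem even_hammingNorm_of_sum_eq_zero {ι : Type*} [Fintype ι] {f : ι → ZMod 2}
    (h : ∑ i, f i = 0) : Even (hammingNorm f) := by
  rw [← ZMod.natCast_eq_zero_iff_even, hammingNorm, Finset.card_filter, Nat.cast_sum]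
  refine Eq.trans ?_ h
  refine Finset.sum_congr rfl fun i _ => ?_
  generalize f i = x
  clear h
  revert x
  decide

theorem hammingNorm_tail_le {r : ℕ} (f : Fin (r + 1) → ZMod 2) :
    hammingNorm (fun j : Fin r => f j.succ) ≤ hammingNorm f := by
  unfold hammingNorm
  rw [← Finset.card_map (Fin.succEmb r)]
  refine Finset.card_le_card fun i hi => ?_
  simp only [Finset.mem_map, Finset.mem_filter, Finset.mem_univ, true_and] at hi ⊢
  obtain ⟨j, hj, rfl⟩ := hi
  exact hj

theorem eq_zero_of_tail_eq_zero {r : ℕ} {f : Fin (r + 1) → ZMod 2} (h : ∑ j, f j = 0)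
    (ht : (fun j : Fin r => f j.succ) = 0) : f = 0 := by
  have hs : ∀ j : Fin r, f j.succ = 0 := congrFun ht
  rw [Fin.sum_univ_succ] at h
  simp only [hs, Finset.sum_const_zero, add_zero] at h
  funext j
  exact Fin.cases h hs j

theorem basisMatrix_mulVec {m t : ℕ} {W : Submodule (ZMod 2) (Fin m → ZMod 2)}
    (e : Basis (Fin t) (ZMod 2) W) (v : Fin t → ZMod 2) :
    basisMatrix e *ᵥ v = ((e.equivFun.symm v : W) : Fin m → ZMod 2) := by
  funext x
  rw [Basis.equivFun_symm_apply]
  simp [basisMatrix, Matrix.mulVec, dotProduct, mul_comm]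

section Code
variable {s t m r l : ℕ} {GU : Matrix (Fin s) (Fin s) (ZMod 2)}
  {W : Fin l → Submodule (ZMod 2) (Fin m → ZMod 2)} {e : ∀ i, Basis (Fin t) (ZMod 2) (W i)}
  {A₁ : Matrix (Fin s) (Fin r) (ZMod 2)} {A₂ : Matrix (Fin t) (Fin r) (ZMod 2)}

/-- A word is in the code iff every block has even weight and the two lower sets of checks hold. -/
theorem mem_spreadCode_iff {c : Fin l × Fin (r + 1) → ZMod 2} :
    c ∈ spreadCode GU e A₁ A₂ ↔ (∀ i, ∑ j, c (i, j) = 0) ∧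
      (GU *ᵥ ∑ i, A₁ *ᵥ (fun j => c (i, j.succ))) = 0 ∧
      ∑ i, basisMatrix (e i) *ᵥ (A₂ *ᵥ fun j => c (i, j.succ)) = 0 := by
  have h₁ : ∀ i, ((parityCheckMatrix fun i => blockHG GU (basisMatrix (e i))
      (fromRows A₁ A₂)) *ᵥ c) (.inl i) = ∑ j, c (i, j) := by
    intro i
    simp only [parityCheckMatrix, Matrix.mulVec, dotProduct, Fintype.sum_prod_type,
      Matrix.fromRows_apply_inl, Matrix.of_apply, ite_mul, one_mul, zero_mul]
    rw [Finset.sum_comm]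
    simp
  have h₂ : ∀ x, ((parityCheckMatrix fun i => blockHG GU (basisMatrix (e i))
      (fromRows A₁ A₂)) *ᵥ c) (.inr (.inl x)) =
      (GU *ᵥ ∑ i, A₁ *ᵥ (fun j => c (i, j.succ))) x := by
    intro x
    rw [Matrix.mulVec_sum, Finset.sum_apply]
    simp only [Matrix.mulVec_mulVec]
    simp [parityCheckMatrix, blockHG, Matrix.mulVec, dotProduct, Fintype.sum_prod_type,
      Fin.sum_univ_succ, Matrix.fromBlocks_mul_fromRows]
  have h₃ : ∀ x, ((parityCheckMatrix fun i => blockHG GU (basisMatrix (e i))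
      (fromRows A₁ A₂)) *ᵥ c) (.inr (.inr x)) =
      (∑ i, basisMatrix (e i) *ᵥ (A₂ *ᵥ fun j => c (i, j.succ))) x := by
    intro x
    rw [Finset.sum_apply]
    simp only [Matrix.mulVec_mulVec]
    simp [parityCheckMatrix, blockHG, Matrix.mulVec, dotProduct, Fintype.sum_prod_type,
      Fin.sum_univ_succ, Matrix.fromBlocks_mul_fromRows]
  rw [spreadCode, parityCheckCode, LinearMap.mem_ker, Matrix.mulVecLin_apply, funext_iff]
  simp only [Sum.forall, h₁, h₂, h₃, Pi.zero_apply, funext_iff]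

theorem finrank_spreadCode_add (hW : ⨆ i, W i = ⊤) (hl : 0 < l) (hGU : GU.rank = s)
    (hA : (fromRows A₁ A₂).rank = s + t) :
    finrank (ZMod 2) (spreadCode GU e A₁ A₂) + (l + (s + m)) = l * (r + 1) := by
  set H := parityCheckMatrix fun i => blockHG GU (basisMatrix (e i)) (fromRows A₁ A₂) with hH
  have hinj : Function.Injective H.vecMul := by
    rw [← Matrix.coe_vecMulLinear, injective_iff_map_eq_zero]
    intro v hv
    obtain ⟨α, w, rfl⟩ : ∃ α w, v = Sum.elim α w := ⟨_, _, (Sum.elim_comp_inl_inr v).symm⟩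
    obtain ⟨β, γ, rfl⟩ : ∃ β γ, w = Sum.elim β γ := ⟨_, _, (Sum.elim_comp_inl_inr w).symm⟩
    have hcol : ∀ i j, (Sum.elim α (Sum.elim β γ) ᵥ* H) (i, j) = 0 := fun i j => congrFun hv (i, j)
    -- Column 0 of each block vanishes in the lower rows, so it isolates `α i`.
    have hα : α = 0 := by
      funext i
      simpa [hH, parityCheckMatrix, blockHG, Matrix.vecMul, dotProduct] using hcol i 0
    have hβγ : ∀ i, Sum.elim (β ᵥ* GU) (γ ᵥ* basisMatrix (e i)) = 0 := by
      intro i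
      apply vecMul_injective_of_rank_eq_card (M := fromRows A₁ A₂) (by simp [hA])
      refine Eq.trans ?_ (Matrix.zero_vecMul _).symm
      funext j
      have h : (Sum.elim β γ ᵥ* (fromBlocks GU 0 0 (basisMatrix (e i)) * fromRows A₁ A₂)) j = 0 := by
        simpa [hH, hα, parityCheckMatrix, blockHG, Matrix.vecMul, dotProduct] using hcol i j.succ
      rw [← Matrix.vecMul_vecMul] at h
      simpa [Matrix.vecMul_fromBlocks] using h
    have hβ : β = 0 := by
      apply vecMul_injective_of_rank_eq_card (M := GU) (by simp [hGU])
      refine Eq.trans ?_ (Matrix.zero_vecMul _).symm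
      funext x
      exact congrFun (hβγ ⟨0, hl⟩) (.inl x)
    have hγ : γ = 0 := by
      -- `γ` is orthogonal to every `W i`, hence to the whole space.
      have hle : ⨆ i, W i ≤ LinearMap.ker (dotProductBilin (ZMod 2) (ZMod 2) γ) := by
        refine iSup_le fun i x hx => ?_
        have hx' : basisMatrix (e i) *ᵥ (e i).equivFun ⟨x, hx⟩ = x := by simp [basisMatrix_mulVec]
        have hz : γ ᵥ* basisMatrix (e i) = 0 := funext fun y => congrFun (hβγ i) (.inr y)
        change γ ⬝ᵥ x = 0
        rw [← hx', Matrix.dotProduct_mulVec, hz, zero_dotProduct]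
      rw [hW] at hle
      funext x
      have h : γ ⬝ᵥ Pi.single x 1 = 0 := hle (Submodule.mem_top (x := Pi.single x 1))
      simpa using h
    subst hα hβ hγ
    funext x
    rcases x with _ | _ | _ <;> rfl
  have hrank : H.rank = l + (s + m) := by
    rw [(Matrix.vecMul_injective_iff.1 hinj).rank_matrix]
    simp
  have h := H.mulVecLin.finrank_range_add_finrank_ker
  rw [← Matrix.rank, hrank] at h
  rw [add_comm]
  exact h.trans (by simp)

theorem six_le_hammingNorm (hW : IsPartialSpread t W) (hGU : GU.rank = s) (hA : IsDesired A₁ A₂)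
    (ht : 3 ≤ t) (hr : 4 ≤ r) {c : Fin l × Fin (r + 1) → ZMod 2}
    (hc : c ∈ spreadCode GU e A₁ A₂) (hc0 : c ≠ 0) : 6 ≤ hammingNorm c := by
  obtain ⟨hpar, hU, hlow⟩ := mem_spreadCode_iff.1 hc
  by_contra! hlt
  let w : Fin l → ℕ := fun i => hammingNorm fun j => c (i, j)
  have hsum : ∑ i, w i = hammingNorm c := by
    simp only [w, hammingNorm, Finset.card_filter, Fintype.sum_prod_type]
  have heven : ∀ i, Even (w i) := fun i => even_hammingNorm_of_sum_eq_zero (hpar i)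
  have hblock : ∀ i, w i = 0 → ∀ j, c (i, j) = 0 := fun i hi j =>
    congrFun (hammingNorm_eq_zero.1 hi) j
  have htail : ∀ i, (fun j : Fin r => c (i, j.succ)) = 0 → w i = 0 := fun i h =>
    hammingNorm_eq_zero.2 (eq_zero_of_tail_eq_zero (hpar i) h)
  have hcol : ∀ {k : ℕ} (A : Matrix (Fin k) (Fin r) (ZMod 2)) (f : Fin r → ZMod 2),
      A *ᵥ f = ∑ j, f j • A.col j := fun A f => by
    rw [Matrix.mulVec_eq_sum]; simp [Matrix.col]
  have hker : ∀ i v, basisMatrix (e i) *ᵥ v = 0 → v = 0 := fun i v h => by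
    rw [basisMatrix_mulVec] at h
    exact (e i).equivFun.symm.map_eq_zero_iff.1 (Subtype.ext h)
  have hGUker : ∀ v, GU *ᵥ v = 0 → v = 0 := by
    have hdet : IsUnit GU := by
      rw [← Matrix.vecMul_injective_iff_isUnit]
      exact vecMul_injective_of_rank_eq_card (by simp [hGU])
    intro v h
    exact Matrix.mulVec_injective_iff_isUnit.2 hdet (by rw [h, Matrix.mulVec_zero])
  obtain ⟨i, hi⟩ : ∃ i, w i ≠ 0 := by
    by_contra! h
    exact hc0 (funext fun p => hblock p.1 (h p.1) p.2)
  -- Even weights with sum at most 5: two nonzero blocks have weight 2 each and leave nothing for a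
  -- third.
  by_cases hex : ∃ k, k ≠ i ∧ w k ≠ 0
  · obtain ⟨k, hki, hk⟩ := hex
    have hle : ∀ p, p ≠ i → p ≠ k → w i + w k + w p ≤ 5 := by
      intro p hpi hpk
      have h := Finset.sum_le_univ_sum_of_nonneg (s := {i, k, p}) (f := w) fun _ => Nat.zero_le _
      rw [Finset.sum_insert (by simp [hki.symm, hpi.symm]), Finset.sum_pair hpk.symm] at h
      omega
    have hle₂ : w i + w k ≤ 5 := by
      have h := Finset.sum_le_univ_sum_of_nonneg (s := {i, k}) (f := w) fun _ => Nat.zero_le _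
      rw [Finset.sum_pair hki.symm] at h
      omega
    have hzero : ∀ p, p ≠ i ∧ p ≠ k → basisMatrix (e p) *ᵥ (A₂ *ᵥ fun j => c (p, j.succ)) = 0 := by
      rintro p ⟨hpi, hpk⟩
      have hwp : w p = 0 := by
        have := hle p hpi hpk
        have := heven i; have := heven k; have := heven p
        grind
      rw [show (fun j : Fin r => c (p, j.succ)) = 0 from funext fun j => hblock p hwp j.succ]
      simp
    rw [Fintype.sum_eq_add i k hki.symm hzero, add_eq_zero_iff_eq_neg] at hlow
    have hmem : basisMatrix (e i) *ᵥ (A₂ *ᵥ fun j => c (i, j.succ)) ∈ W i ⊓ W k := by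
      refine ⟨by rw [basisMatrix_mulVec]; exact Subtype.prop _, ?_⟩
      rw [hlow, basisMatrix_mulVec]
      exact neg_mem (Subtype.prop _)
    rw [hW.2 hki.symm, Submodule.mem_bot] at hmem
    have hv := hker i _ hmem
    rw [hcol] at hv
    refine hi (htail i (eq_zero_of_sum_smul_eq_zero_of_card_le (k := 2)
      (by simp; omega) hA.two_cols ?_ hv))
    have hwi : w i ≤ 2 := by
      have := heven i; have := heven k
      grind
    exact (hammingNorm_tail_le _).trans hwi
  · push Not at hex
    have hz : ∀ p, p ≠ i → (fun j : Fin r => c (p, j.succ)) = 0 := fun p hp =>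
      funext fun j => hblock p (hex p hp) j.succ
    rw [Fintype.sum_eq_single i fun p hp => by rw [hz p hp, Matrix.mulVec_zero]] at hU
    rw [Fintype.sum_eq_single i fun p hp => by rw [hz p hp, Matrix.mulVec_zero, Matrix.mulVec_zero]]
      at hlow
    have h₁ := hGUker _ hU
    have h₂ := hker i _ hlow
    have hv : ∑ j : Fin r, c (i, j.succ) • (fromRows A₁ A₂).col j = 0 := by
      rw [hcol] at h₁ h₂
      funext x
      rcases x with x | x
      · simpa using congrFun h₁ x
      · simpa using congrFun h₂ x
    refine hi (htail i (eq_zero_of_sum_smul_eq_zero_of_card_le (k := 4)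
      (by simpa using hr) (hA.four_cols ht) ?_ hv))
    have hwi : w i ≤ 4 := by
      have h := Finset.single_le_sum (f := w) (fun _ _ => Nat.zero_le _) (Finset.mem_univ i)
      have := heven i
      grind
    exact (hammingNorm_tail_le _).trans hwi

/-- Positive dimension is needed because `sInf ∅ = 0`. -/
theorem le_minDist {ι : Type*} [Fintype ι] {C : Submodule (ZMod 2) (ι → ZMod 2)} {d : ℕ}
    (hC : 0 < finrank (ZMod 2) C) (h : ∀ c ∈ C, c ≠ 0 → d ≤ hammingNorm c) : d ≤ minDist C := by
  have : Nontrivial C := Module.finrank_pos_iff.1 hC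
  obtain ⟨x, y, hxy⟩ := exists_pair_ne C
  refine le_csInf ⟨_, x, x.2, y, y.2, fun h => hxy (Subtype.ext h), rfl⟩ ?_
  rintro _ ⟨x, hx, y, hy, hne, rfl⟩
  rw [hammingDist_eq_hammingNorm]
  refine h _ (add_mem (neg_mem hx) hy) fun h0 => hne ?_
  rwa [neg_add_eq_zero] at h0

theorem hasLocality_spreadCode : HasLocality (spreadCode GU e A₁ A₂) r := by
  classical
  rintro ⟨i, j⟩
  refine ⟨(Finset.univ.erase j).map (.sectR i _), by simp, by simp, fun c hc => ?_⟩
  have h := (mem_spreadCode_iff.1 hc).1 i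
  rw [← Finset.add_sum_erase _ _ (Finset.mem_univ j), add_eq_zero_iff_eq_neg] at h
  rw [h, Finset.sum_map]
  exact CharTwo.neg_eq _

theorem hasDisjointRepairGroups_spreadCode :
    HasDisjointRepairGroups (spreadCode GU e A₁ A₂) r := by
  refine ⟨l, by simp [mul_comm], fun i p => if p.1 = i then 1 else 0, fun i c hc => ?_, fun i => ?_,
    fun i k hik => ?_⟩
  · refine Eq.trans ?_ ((mem_spreadCode_iff.1 hc).1 i)
    simp only [dotProduct, Fintype.sum_prod_type, ite_mul, one_mul, zero_mul]
    rw [Finset.sum_comm]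
    simp
  · have hset : ({p | (if p.1 = i then 1 else 0 : ZMod 2) ≠ 0} : Finset (Fin l × Fin (r + 1))) =
        Finset.univ.map (.sectR i (Fin (r + 1))) := by
      ext ⟨x, y⟩
      simp [eq_comm]
    rw [hammingNorm, hset]
    simp
  · refine Set.disjoint_left.2 fun p hp hq => ?_
    have hp : p.1 = i := by simpa using hp
    have hq : p.1 = k := by simpa using hq
    exact hik (hp.symm.trans hq)
end Code
end BinLRC

/-! ### Estimates for the dimension bound -/

namespace BinLRC
-- Here `B, S, T, Z, M` stand for 2 to the powers `b, s, t, z, m`. Multiplying by `T - 1` eliminates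
-- `l`; the result is `log₂ (1 + r * n / 2) ≤ s + m`.
theorem mul_size_add_two_le {B S T Z M l : ℤ} (hE : l * T + T * Z + 1 = M + T + l)
    (hST : S * T = B ^ 2) (hZ : 2 ≤ Z) (hSB : 2 * S ≤ B) (hB : 4 ≤ B) (hT : 2 ≤ T) (hM : 0 ≤ M) :
    B * (B + 1) * l + 2 ≤ 2 * (S * M) := by
  have hl : l * (T - 1) = M - T * Z + T - 1 := by linarith
  refine le_of_mul_le_mul_right (a := T - 1) ?_ (by linarith)
  have h₁ : (B * (B + 1) * l + 2) * (T - 1) = B * (B + 1) * (M - T * Z + T - 1) + 2 * (T - 1) := by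
    rw [← hl]; ring
  have h₂ : 2 * (S * M) * (T - 1) = 2 * (B ^ 2 * M) - 2 * S * M := by rw [← hST]; ring
  have h₃ : T * 2 ≤ T * Z := mul_le_mul_of_nonneg_left hZ (by linarith)
  have h₄ : B * (B + 1) * (M - T * Z + T - 1) ≤ B * (B + 1) * (M - T) :=
    mul_le_mul_of_nonneg_left (by linarith) (by positivity)
  have h₅ : 2 * S * M ≤ B * M := mul_le_mul_of_nonneg_right hSB hM
  have h₆ : 2 * B * M ≤ B ^ 2 * M := mul_le_mul_of_nonneg_right (by nlinarith) hM
  have h₇ : 2 * T ≤ B * (B + 1) * T := mul_le_mul_of_nonneg_right (by nlinarith) (by linarith)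
  linarith

/-- The companion bound `s + m - 1 < log₂ (1 + r * n / 2)`. The loss `T * Z` in `l * (T - 1)` is
absorbed through `Z ≤ B` and `B ^ 4 ≤ M`. -/
theorem lt_mul_size_add_two {B S T Z M l : ℤ} (hE : l * T + T * Z + 1 = M + T + l)
    (hST : S * T = B ^ 2) (hZB : Z ≤ B) (hS : 2 ≤ S) (hB : 4 ≤ B) (hT : 2 ≤ T)
    (hM : B ^ 4 ≤ M) : S * M < B * (B + 1) * l + 2 := by
  have hl : l * (T - 1) = M - T * Z + T - 1 := by linarith
  refine lt_of_mul_lt_mul_right (a := T - 1) ?_ (by linarith)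
  have hM0 : 0 ≤ M := le_trans (by positivity) hM
  have h₁ : (B * (B + 1) * l + 2) * (T - 1) = B * (B + 1) * (M - T * Z + T - 1) + 2 * (T - 1) := by
    rw [← hl]; ring
  have h₂ : S * M * (T - 1) = B ^ 2 * M - S * M := by rw [← hST]; ring
  have h₃ : B * (B + 1) * (T * Z) ≤ B * (B + 1) * (T * B) := by gcongr
  have h₄ : 2 * T ≤ B ^ 2 := by rw [← hST]; exact mul_le_mul_of_nonneg_right hS (by linarith)
  have h₅ : B ^ 2 * (B + 1) * (2 * T) ≤ B ^ 2 * (B + 1) * B ^ 2 := by gcongr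
  have h₆ : B ^ 4 * (B + 1) ≤ 2 * (B * B ^ 4) := by nlinarith [pow_pos (show 0 < B by linarith) 4]
  have h₇ : B * B ^ 4 ≤ B * M := by gcongr
  have h₈ : 0 ≤ S * M := by positivity
  have h₉ : 0 ≤ B * (B + 1) * (T - 1) := mul_nonneg (by positivity) (by linarith)
  linarith

theorem two_pow_lt_size {t u z l : ℕ} (ht : 1 ≤ t) (hu : t + z ≤ u)
    (hE : l * 2 ^ t + 2 ^ (t + z) + 1 = 2 ^ (t + u) + 2 ^ t + l) : 2 ^ u < l := by
  have hT : 2 ≤ 2 ^ t := by simpa using Nat.pow_le_pow_right two_pos ht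
  have hU : 2 ^ (t + z) ≤ 2 ^ u := Nat.pow_le_pow_right two_pos hu
  rw [pow_add 2 t u] at hE
  by_contra! h
  obtain ⟨x, hx⟩ := Nat.exists_eq_add_of_le h
  obtain ⟨y, hy⟩ := Nat.exists_eq_add_of_le hT
  rw [hy] at hE
  rw [hx] at hE hU
  nlinarith

theorem three_mul_le_two_pow_add_three (u : ℕ) : 3 * u ≤ 2 ^ u + 3 := by
  induction u with
  | zero => simp
  | succ n ih =>
    rcases n with _ | _ | n
    · simp
    · simp
    · rw [pow_succ]
      have : 4 * 1 ≤ 2 ^ (n + 1 + 1) := by rw [pow_add, pow_add]; linarith [Nat.one_le_two_pow (n := n)]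
      have : n < 2 ^ n := n.lt_two_pow_self
      rw [pow_add 2 n] at *
      omega

/-- The other term of the minimum, `r * l / (r + 2)`, exceeds `s + m - 1` because `l` is exponential
in `u` while `s + m < 2 * u`. -/
theorem redundancy_mul_lt {B s m u l : ℕ} (hB : 4 ≤ B) (h : s + m + 1 ≤ 2 * u) (hl : 2 ^ u < l) :
    (s + m) * (B + 2) < B * l + (B + 2) := by
  have h₁ := three_mul_le_two_pow_add_three u
  have h₂ : (s + m + 1) * (B + 2) ≤ 2 * u * (B + 2) := Nat.mul_le_mul_right _ h
  have h₃ : B * (3 * u + 1) ≤ B * (l + 3) := Nat.mul_le_mul_left _ (by omega)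
  have h₄ : u * 4 ≤ u * B := Nat.mul_le_mul_left _ hB
  rcases Nat.eq_zero_or_pos u with rfl | hu
  · omega
  · obtain ⟨v, rfl⟩ := Nat.exists_eq_add_of_le' hu
    nlinarith [Nat.mul_le_mul_left v hB]

theorem floor_dimBound {r l k : ℕ} (hr : 1 ≤ r) (hle : r * (r + 1) * l + 2 ≤ 2 * 2 ^ k)
    (hlt : 2 ^ k < r * (r + 1) * l + 2) (hk : k * (r + 2) < r * l + (r + 2)) :
    ⌊dimBound ((r + 1) * l) r⌋ = (r * l : ℤ) - k := by
  have hle' : (r * (r + 1) * l + 2 : ℝ) ≤ 2 * 2 ^ k := by exact_mod_cast hle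
  have hlt' : (2 ^ k : ℝ) < r * (r + 1) * l + 2 := by exact_mod_cast hlt
  have hk' : (k * (r + 2) : ℝ) < r * l + (r + 2) := by exact_mod_cast hk
  have hr0 : (0 : ℝ) < r := by exact_mod_cast hr
  have hpos : (0 : ℝ) < 1 + r * ((r + 1) * l) / 2 := by positivity
  have h₁ : (r * ((r + 1) * l) / (r + 1) : ℝ) = r * l := by field_simp
  have h₂ : (r * ((r + 1) * l) / ((r + 1) * (r + 2)) : ℝ) = r * l / (r + 2) := by field_simp
  have h₃ : Real.logb 2 (1 + r * ((r + 1) * l) / 2) ≤ k := by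
    rw [Real.logb_le_iff_le_rpow one_lt_two hpos, Real.rpow_natCast]
    linarith
  have h₄ : (k - 1 : ℝ) < Real.logb 2 (1 + r * ((r + 1) * l) / 2) := by
    rw [Real.lt_logb_iff_rpow_lt one_lt_two hpos, Real.rpow_sub_one two_ne_zero, Real.rpow_natCast]
    linarith
  have h₅ : (k - 1 : ℝ) < r * l / (r + 2) := by
    rw [lt_div_iff₀ (by positivity)]
    linarith
  rw [Int.floor_eq_iff, dimBound]
  push_cast
  rw [h₁, h₂]
  have h₆ := min_le_left (Real.logb 2 (1 + r * ((r + 1) * l) / 2)) (r * l / (r + 2) : ℝ)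
  have h₇ := lt_min h₄ h₅
  constructor <;> linarith
end BinLRC

/-! ### The main theorem -/

open BinLRC in
theorem theorem3 (b s m z : ℕ) (hs : 1 ≤ s) (hsb : s < b) (hm : 4 * b ≤ m)
    (hdvd : ¬ (2 * b - s) ∣ m) (hz : z ≡ m [MOD 2 * b - s]) (hzb : z ≤ b) :
    ∃ l : ℕ,
      (l : ℚ) = (2 ^ m - 2 ^ (2 * b - s) * (2 ^ z - 1) - 1) / (2 ^ (2 * b - s) - 1) ∧
      (∃ W : Fin l → Submodule (ZMod 2) (Fin m → ZMod 2), IsPartialSpread (2 * b - s) W) ∧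
      ∀ (W : Fin l → Submodule (ZMod 2) (Fin m → ZMod 2)), IsPartialSpread (2 * b - s) W →
      ∀ (e : ∀ i, Module.Basis (Fin (2 * b - s)) (ZMod 2) (W i))
        (GU : Matrix (Fin s) (Fin s) (ZMod 2)), GU.rank = s →
      ∀ (A₁ : Matrix (Fin s) (Fin (2 ^ b)) (ZMod 2))
        (A₂ : Matrix (Fin (2 * b - s)) (Fin (2 ^ b)) (ZMod 2)), IsDesired A₁ A₂ →
      ∃ n : ℕ, n = (2 ^ b + 1) * l ∧
        Fintype.card (Fin l × Fin (2 ^ b + 1)) = n ∧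
        (Module.finrank (ZMod 2) (spreadCode GU e A₁ A₂) : ℤ) = n - l - s - m ∧
        6 ≤ minDist (spreadCode GU e A₁ A₂) ∧
        HasLocality (spreadCode GU e A₁ A₂) (2 ^ b) ∧
        HasDisjointRepairGroups (spreadCode GU e A₁ A₂) (2 ^ b) ∧
        IsKOptimal (spreadCode GU e A₁ A₂) (2 ^ b) := by
  generalize ht : 2 * b - s = t at *
  have hz0 : 1 ≤ z := by
    rw [Nat.one_le_iff_ne_zero]
    rintro rfl
    exact hdvd ((Nat.modEq_zero_iff_dvd).1 hz.symm)
  have hzm : m % t = z := by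
    rw [← hz, Nat.mod_eq_of_lt (by omega)]
  -- The quotient is at least 2 because `2 * t = 4 * b - 2 * s < m`.
  obtain ⟨q, hq⟩ : ∃ q, m = t * (q + 2) + z := by
    have hdiv : 2 ≤ m / t := (Nat.le_div_iff_mul_le (by omega)).2 (by omega)
    refine ⟨m / t - 2, ?_⟩
    rw [Nat.sub_add_cancel hdiv, ← hzm, Nat.div_add_mod]
  obtain ⟨l, hl, hspread⟩ := exists_isPartialSpread t z (by omega) (q + 1)
  rw [show t * (q + 1 + 1) + z = m by rw [hq]] at hl hspread
  obtain ⟨u, hu⟩ : ∃ u, m = t + u := ⟨m - t, by omega⟩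
  have htz : t + z ≤ u := by
    have : t * (q + 2) = t + (t + t * q) := by ring
    omega
  have hul : 2 ^ u < l := two_pow_lt_size (t := t) (z := z) (by omega) htz (hu ▸ hl)
  have hb4 : 4 ≤ 2 ^ b := by simpa using Nat.pow_le_pow_right two_pos (show 2 ≤ b by omega)
  have hs2 : 2 ≤ 2 ^ s := by simpa using Nat.pow_le_pow_right two_pos hs
  have ht2 : 2 ≤ 2 ^ t := by simpa using Nat.pow_le_pow_right two_pos (show 1 ≤ t by omega)
  have hz2 : 2 ≤ 2 ^ z := by simpa using Nat.pow_le_pow_right two_pos hz0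
  have hzb' : 2 ^ z ≤ 2 ^ b := Nat.pow_le_pow_right two_pos hzb
  have hsb' : 2 * 2 ^ s ≤ 2 ^ b := by
    rw [← pow_succ']
    exact Nat.pow_le_pow_right two_pos hsb
  have hst : 2 ^ s * 2 ^ t = (2 ^ b) ^ 2 := by
    rw [← pow_add, ← pow_mul]
    congr 1
    omega
  have hbm : (2 ^ b) ^ 4 ≤ 2 ^ m := by
    rw [← pow_mul]
    exact Nat.pow_le_pow_right two_pos (by omega)
  have hE : (l : ℤ) * 2 ^ t + 2 ^ t * 2 ^ z + 1 = 2 ^ m + 2 ^ t + l := by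
    rw [← pow_add]
    exact_mod_cast hl
  have hupper : 2 ^ b * (2 ^ b + 1) * l + 2 ≤ 2 * 2 ^ (s + m) := by
    rw [pow_add]
    exact_mod_cast mul_size_add_two_le (B := 2 ^ b) (S := 2 ^ s) hE (by exact_mod_cast hst)
      (by exact_mod_cast hz2)
      (by exact_mod_cast hsb') (by exact_mod_cast hb4) (by exact_mod_cast ht2) (by positivity)
  have hlower : 2 ^ (s + m) < 2 ^ b * (2 ^ b + 1) * l + 2 := by
    rw [pow_add]
    exact_mod_cast lt_mul_size_add_two (B := 2 ^ b) (S := 2 ^ s) hE (by exact_mod_cast hst)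
      (by exact_mod_cast hzb')
      (by exact_mod_cast hs2) (by exact_mod_cast hb4) (by exact_mod_cast ht2)
      (by exact_mod_cast hbm)
  -- With `u = m - t`, the condition `s + m + 1 ≤ 2 * u` amounts to `4 * b + 1 ≤ m + s`.
  have hred : (s + m) * (2 ^ b + 2) < 2 ^ b * l + (2 ^ b + 2) :=
    redundancy_mul_lt hb4 (u := u) (by omega) hul
  have hkpos : s + m < 2 ^ b * l := by nlinarith
  have hl4 : 4 ≤ l := by
    have : 2 ^ 2 ≤ 2 ^ u := Nat.pow_le_pow_right two_pos (by omega)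
    omega
  have hcard : 2 ^ m < 2 * (l * (2 ^ t - 1) + 1) := by
    have h₁ : 2 * 2 ^ (t + z) ≤ 2 ^ m := by
      rw [← pow_succ']
      exact Nat.pow_le_pow_right two_pos (by omega)
    have h₂ : l * (2 ^ t - 1) + l = l * 2 ^ t := by
      rw [← Nat.mul_succ, Nat.succ_eq_add_one, Nat.sub_add_cancel (by omega)]
    omega
  refine ⟨l, ?_, hspread, fun W hW e GU hGU A₁ A₂ hA => ⟨_, rfl, by simp [mul_comm], ?_⟩⟩
  · have hEq : (l : ℚ) * 2 ^ t + 2 ^ t * 2 ^ z + 1 = 2 ^ m + 2 ^ t + l := by exact_mod_cast hE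
    have ht1 : (2 : ℚ) ≤ 2 ^ t := by exact_mod_cast ht2
    rw [eq_div_iff (by linarith)]
    linarith
  have hdim := finrank_spreadCode_add (e := e) (iSup_eq_top_of_isPartialSpread hW hcard)
    (by omega) hGU hA.full_rank
  rw [mul_add, mul_one, mul_comm l] at hdim
  have hdim' : (Module.finrank (ZMod 2) (spreadCode GU e A₁ A₂) : ℤ) =
      (2 ^ b * l : ℤ) - (s + m : ℕ) := by
    have : (Module.finrank (ZMod 2) (spreadCode GU e A₁ A₂) : ℤ) + (l + (s + m)) = 2 ^ b * l + l := by
      exact_mod_cast hdim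
    push_cast
    linarith
  have hd : 6 ≤ minDist (spreadCode GU e A₁ A₂) :=
    le_minDist (by omega) fun c hc hc0 =>
      six_le_hammingNorm hW hGU hA (by omega) hb4 hc hc0
  refine ⟨?_, hd, hasLocality_spreadCode, hasDisjointRepairGroups_spreadCode,
    hasLocality_spreadCode, by omega, by omega, ?_, ?_⟩
  · rw [hdim']
    push_cast
    ring
  · have hl4' : (4 : ℝ) ≤ l := by exact_mod_cast hl4
    simp only [Fintype.card_prod, Fintype.card_fin, Nat.cast_mul, Nat.cast_add, Nat.cast_pow,
      Nat.cast_ofNat, Nat.cast_one]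
    nlinarith [pow_pos (two_pos (α := ℝ)) b]
  · have hfloor := floor_dimBound (by omega) hupper hlower hred
    rw [hdim', Fintype.card_prod, Fintype.card_fin, Fintype.card_fin, mul_comm l, hfloor]
    push_cast
    ring
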